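/- Let $k$ be a field of characteristic different from $2$ and $3$, and let $L$ be a Mal'tsev algebra over $k$ (of any dimension), i.e. a $k$-vector space with a bilinear alternating bracket satisfying $[J(x,y,z),x]=J(x,y,[x,z])$, where $J(x,y,z)=[x,[y,z]]+[y,[z,x]]+[z,[x,y]]$. Let $U(L)$ be the quotient of the free unital nonassociative $k$-algebra on the vector space $L$ by the ideal imposing the relations $$xy-yx=[x,y],\qquad (x,h,g)+(h,x,g)=0,\qquad (h,x,g)+(h,g,x)=0$$ for all $x,y\in L$ and all $h,g$ in the free algebra, where $(a,b,c)=(ab)c-a(bc)$. Let $\Delta:U(L)\to U(L)\otimes U(L)$ and $\varepsilon:U(L)\to k$ be the homomorphisms of unital algebras, and $S:U(L)\to U(L)$ the linear antihomomorphism of unital algebras, with $$\Delta x=x\otimes 1+1\otimes x,\qquad \varepsilon(x)=0,\qquad Sx=-x\qquad(x\in L).$$ Then $U(L)$ with these maps is a Moufang Hopf quasigroup. That is, $\Delta$ and $\varepsilon$ are homomorphisms of unital algebras forming a coassociative counital coalgebra, and for all $h,g,f\in U(L)$, writing $\Delta h=h_{(1)}\otimes h_{(2)}$, $$S(h_{(1)})(h_{(2)}g)=\varepsilon(h)g=h_{(1)}(S(h_{(2)})g),\qquad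 (hS(g_{(1)}))g_{(2)}=h\,\varepsilon(g)=(hg_{(1)})S(g_{(2)}),$$ and the Moufang identity holds: $$h_{(1)}(g(h_{(2)}f))=((h_{(1)}g)h_{(2)})f .$$ -/

import Mathlib

open scoped TensorProduct

/-- A Mal'tsev algebra over `k`: a `k`-module `L` with a bilinear alternating bracket such that
`⁅J(x,y,z), x⁆ = J(x,y,⁅x,z⁆)` for `J(x,y,z) = ⁅x,⁅y,z⁆⁆ + ⁅y,⁅z,x⁆⁆ + ⁅z,⁅x,y⁆⁆`. -/
class MaltsevAlgebra (k L : Type*) [CommRing k] [AddCommGroup L] [Module k L]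
    extends Bracket L L where
  add_bracket : ∀ x y z : L, ⁅x + y, z⁆ = ⁅x, z⁆ + ⁅y, z⁆
  bracket_add : ∀ x y z : L, ⁅x, y + z⁆ = ⁅x, y⁆ + ⁅x, z⁆
  smul_bracket : ∀ (c : k) (x y : L), ⁅c • x, y⁆ = c • ⁅x, y⁆
  bracket_smul : ∀ (c : k) (x y : L), ⁅x, c • y⁆ = c • ⁅x, y⁆
  bracket_self : ∀ x : L, ⁅x, x⁆ = 0
  maltsev : ∀ x y z : L,
    ⁅⁅x, ⁅y, z⁆⁆ + ⁅y, ⁅z, x⁆⁆ + ⁅z, ⁅x, y⁆⁆, x⁆ =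
      ⁅x, ⁅y, ⁅x, z⁆⁆⁆ + ⁅y, ⁅⁅x, z⁆, x⁆⁆ + ⁅⁅x, z⁆, ⁅x, y⁆⁆

/-! ### Hopf quasigroups -/

section HopfQuasigroup

variable (k H : Type*) [CommRing k] [NonAssocRing H] [Module k H] [IsScalarTower k H H]
  [SMulCommClass k H H] [Coalgebra k H]

open Coalgebra LinearMap

/-- A possibly nonassociative unital algebra `H` which is also a (coassociative, counital)
coalgebra is a Hopf quasigroup with antipode `S` if `Δ` and `ε` are homomorphisms of unital
algebras and, in Sweedler notation,
`S(h₁)(h₂ g) = ε(h) g = h₁(S(h₂) g)` and `(h S(g₁)) g₂ = h ε(g) = (h g₁) S(g₂)`. -/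
structure IsHopfQuasigroup (S : H →ₗ[k] H) : Prop where
  comul_one : comul (R := k) (1 : H) = 1
  comul_mul : ∀ h g : H, comul (R := k) (h * g) = comul (R := k) h * comul (R := k) g
  counit_one : counit (R := k) (1 : H) = 1
  counit_mul : ∀ h g : H, counit (R := k) (h * g) = counit (R := k) h * counit (R := k) g
  /-- `m (id ⊗ m) (S ⊗ id ⊗ id) (Δ ⊗ id) = ε ⊗ id` -/
  antipode_mul_left :
    mul' k H ∘ₗ lTensor H (mul' k H) ∘ₗ TensorProduct.map S (TensorProduct.map id id) ∘ₗ
        (TensorProduct.assoc k H H H).toLinearMap ∘ₗ rTensor H comul =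
      (TensorProduct.lid k H).toLinearMap ∘ₗ rTensor H counit
  /-- `m (id ⊗ m) (id ⊗ S ⊗ id) (Δ ⊗ id) = ε ⊗ id` -/
  mul_antipode_left :
    mul' k H ∘ₗ lTensor H (mul' k H) ∘ₗ TensorProduct.map id (TensorProduct.map S id) ∘ₗ
        (TensorProduct.assoc k H H H).toLinearMap ∘ₗ rTensor H comul =
      (TensorProduct.lid k H).toLinearMap ∘ₗ rTensor H counit
  /-- `m (m ⊗ id) (id ⊗ S ⊗ id) (id ⊗ Δ) = id ⊗ ε` -/
  antipode_mul_right :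
    mul' k H ∘ₗ rTensor H (mul' k H) ∘ₗ TensorProduct.map (TensorProduct.map id S) id ∘ₗ
        (TensorProduct.assoc k H H H).symm.toLinearMap ∘ₗ lTensor H comul =
      (TensorProduct.rid k H).toLinearMap ∘ₗ lTensor H counit
  /-- `m (m ⊗ id) (id ⊗ id ⊗ S) (id ⊗ Δ) = id ⊗ ε` -/
  mul_antipode_right :
    mul' k H ∘ₗ rTensor H (mul' k H) ∘ₗ TensorProduct.map (TensorProduct.map id id) S ∘ₗ
        (TensorProduct.assoc k H H H).symm.toLinearMap ∘ₗ lTensor H comul =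
      (TensorProduct.rid k H).toLinearMap ∘ₗ lTensor H counit

/-- The Moufang identity `h₁(g(h₂ f)) = ((h₁ g)h₂) f` for all `h, g, f`, where
`Δ h = h₁ ⊗ h₂` in Sweedler notation, that is, `Δ h = ∑ i, a i ⊗ b i` is any expression of `Δ h`
as a finite sum of pure tensors. -/
def IsMoufang : Prop :=
  ∀ (h g f : H) (n : ℕ) (a b : Fin n → H), comul (R := k) h = ∑ i, a i ⊗ₜ[k] b i →
    ∑ i, a i * (g * (b i * f)) = ∑ i, ((a i * g) * b i) * f

end HopfQuasigroup

/-! ### The enveloping algebra of a Mal'tsev algebra -/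

namespace MaltsevAlgebra

noncomputable section

variable (k L : Type*) [CommRing k]

/-- The free unital nonassociative `k`-algebra on the set `L`: its basis consists of `1` and all
nonempty nonassociative words in elements of `L`. -/
abbrev FreeAlg := MonoidAlgebra k (WithOne (FreeMagma L))

variable {L} in
/-- The generator of the free algebra that belongs to `x`. -/
def gen (x : L) : FreeAlg k L := MonoidAlgebra.single (FreeMagma.of x : WithOne (FreeMagma L)) 1

section FreeLift

variable {k L} {A : Type*} [NonAssocRing A] [Module k A] [IsScalarTower k A A] [SMulCommClass k A A]

/-- The homomorphism of unital algebras from the free algebra that extends `f`. -/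
def freeLift (f : L → A) : FreeAlg k L →ₙₐ[k] A :=
  MonoidAlgebra.liftMagma k (WithOne.lift (FreeMagma.lift f)).toMulHom

theorem freeLift_gen (f : L → A) (x : L) : freeLift f (gen k x) = f x := by
  simp [freeLift, gen]

theorem freeLift_one (f : L → A) : freeLift (k := k) f 1 = 1 := by
  simp [freeLift, MonoidAlgebra.one_def]

end FreeLift

variable [AddCommGroup L] [Module k L] [MaltsevAlgebra k L]

/-- The defining relations of the enveloping algebra. The first two make the generators depend
linearly on the elements of `L`; the others are `xy - yx = [x,y]`, `(x,h,g) + (h,x,g) = 0` and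
`(h,x,g) + (h,g,x) = 0` for `x, y` in `L` and `h, g` in the free algebra, where
`(a,b,c) = (ab)c - a(bc)`. -/
inductive Rel : FreeAlg k L → FreeAlg k L → Prop
  | add (x y : L) : Rel (gen k (x + y)) (gen k x + gen k y)
  | smul (c : k) (x : L) : Rel (gen k (c • x)) (c • gen k x)
  | comm (x y : L) : Rel (gen k x * gen k y - gen k y * gen k x) (gen k ⁅x, y⁆)
  | left (x : L) (h g : FreeAlg k L) :
      Rel (associator (gen k x) h g + associator h (gen k x) g) 0
  | right (x : L) (h g : FreeAlg k L) :
      Rel (associator h (gen k x) g + associator h g (gen k x)) 0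

/-- The enveloping algebra `U(L)`: the quotient of the free unital nonassociative algebra by the
ideal that the relations generate. -/
def Envelope : Type _ := (ringConGen (Rel k L)).Quotient

namespace Envelope

instance : NonAssocRing (Envelope k L) := inferInstanceAs (NonAssocRing (RingCon.Quotient _))

instance : DistribMulAction k (Envelope k L) :=
  inferInstanceAs (DistribMulAction k (RingCon.Quotient _))

/-- The quotient map from the free algebra. -/
def mk : FreeAlg k L →+* Envelope k L := RingCon.mk' (ringConGen (Rel k L))

theorem mk_surjective : Function.Surjective (mk k L) :=
  RingCon.mk'_surjective (c := ringConGen (Rel k L))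

theorem mk_smul (c : k) (a : FreeAlg k L) : mk k L (c • a) = c • mk k L a := rfl

theorem mk_rel {a b : FreeAlg k L} (h : Rel k L a b) : mk k L a = mk k L b :=
  ((ringConGen (Rel k L)).eq).2 (RingConGen.Rel.of _ _ h)

instance : Module k (Envelope k L) where
  add_smul c d a := by
    obtain ⟨a, rfl⟩ := mk_surjective k L a
    rw [← mk_smul, ← mk_smul, ← mk_smul, add_smul, map_add]
  zero_smul a := by
    obtain ⟨a, rfl⟩ := mk_surjective k L a
    rw [← mk_smul, zero_smul, map_zero]

instance : IsScalarTower k (Envelope k L) (Envelope k L) :=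
  inferInstanceAs (IsScalarTower k (RingCon.Quotient _) (RingCon.Quotient _))

instance : SMulCommClass k (Envelope k L) (Envelope k L) :=
  inferInstanceAs (SMulCommClass k (RingCon.Quotient _) (RingCon.Quotient _))

/-- The canonical linear map `L → U(L)`. -/
def ι : L →ₗ[k] Envelope k L where
  toFun x := mk k L (gen k x)
  map_add' x y := by rw [mk_rel k L (.add x y), map_add]
  map_smul' c x := by rw [mk_rel k L (.smul c x), mk_smul, RingHom.id_apply]

theorem map_associator {A B : Type*} [NonAssocRing A] [NonAssocRing B] (f : A →+* B) (a b c : A) :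
    f (associator a b c) = associator (f a) (f b) (f c) := by
  simp [associator]

theorem ι_comm (x y : L) : ι k L x * ι k L y - ι k L y * ι k L x = ι k L ⁅x, y⁆ := by
  have := mk_rel k L (.comm x y)
  rwa [map_sub, map_mul, map_mul] at this

theorem ι_left (x : L) (h g : Envelope k L) :
    associator (ι k L x) h g + associator h (ι k L x) g = 0 := by
  obtain ⟨h, rfl⟩ := mk_surjective k L h
  obtain ⟨g, rfl⟩ := mk_surjective k L g
  have := mk_rel k L (.left x h g)
  rwa [map_add, map_associator, map_associator, map_zero] at this

theorem ι_right (x : L) (h g : Envelope k L) :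
    associator h (ι k L x) g + associator h g (ι k L x) = 0 := by
  obtain ⟨h, rfl⟩ := mk_surjective k L h
  obtain ⟨g, rfl⟩ := mk_surjective k L g
  have := mk_rel k L (.right x h g)
  rwa [map_add, map_associator, map_associator, map_zero] at this

variable {k L} in
/-- `U(L)` is generated by `L` as a unital algebra. -/
theorem induction {P : Envelope k L → Prop} (one : P 1) (of : ∀ x, P (ι k L x))
    (add : ∀ a b, P a → P b → P (a + b)) (smul : ∀ (c : k) a, P a → P (c • a))
    (mul : ∀ a b, P a → P b → P (a * b)) (a : Envelope k L) : P a := by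
  obtain ⟨a, rfl⟩ := mk_surjective k L a
  have word : ∀ w : WithOne (FreeMagma L), P (mk k L (MonoidAlgebra.single w 1)) := by
    intro w
    cases w with
    | one =>
      have : (MonoidAlgebra.single (1 : WithOne (FreeMagma L)) (1 : k)) = 1 := rfl
      rw [this, map_one]; exact one
    | coe w =>
      induction w with
      | ih1 x => exact of x
      | ih2 v w hv hw =>
        have h := mul _ _ hv hw
        rw [← map_mul, MonoidAlgebra.single_mul_single, one_mul] at h
        exact h
  induction a using MonoidAlgebra.induction_linear with
  | zero => rw [map_zero, ← zero_smul k (1 : Envelope k L)]; exact smul 0 1 one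
  | add a b ha hb => rw [map_add]; exact add _ _ ha hb
  | single w c =>
    have h := smul c _ (word w)
    rw [← mk_smul, MonoidAlgebra.smul_single, smul_eq_mul, mul_one] at h
    exact h

section Lift

variable {k L} {A : Type*} [NonAssocRing A] [Module k A] [IsScalarTower k A A] [SMulCommClass k A A]

/-- The universal property of `U(L)`: a linear map `f : L → A` to a unital algebra that satisfies
the defining relations extends to a homomorphism of unital algebras. -/
def lift (f : L →ₗ[k] A) (comm : ∀ x y, f x * f y - f y * f x = f ⁅x, y⁆)
    (left : ∀ x a b, associator (f x) a b + associator a (f x) b = 0)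
    (right : ∀ x a b, associator a (f x) b + associator a b (f x) = 0) :
    Envelope k L →ₙₐ[k] A :=
  let F : FreeAlg k L →+* A :=
    { toFun := freeLift f
      map_one' := freeLift_one f
      map_mul' := map_mul _
      map_zero' := map_zero _
      map_add' := map_add _ }
  have hF (x) : F (gen k x) = f x := freeLift_gen f x
  have hs (c : k) (a) : F (c • a) = c • F a := map_smul (freeLift f) c a
  have key : ringConGen (Rel k L) ≤ RingCon.ker F := by
    rw [RingCon.ringConGen_le]
    intro a b h
    change F a = F b
    cases h with
    | add x y => rw [map_add, hF, hF, hF, map_add]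
    | smul c x => rw [hs, hF, hF, map_smul]
    | comm x y => rw [map_sub, map_mul, map_mul, hF, hF, hF, comm]
    | left x h g => rw [map_add, map_associator, map_associator, hF, left, map_zero]
    | right x h g => rw [map_add, map_associator, map_associator, hF, right, map_zero]
  let G : Envelope k L →+* A := RingCon.lift _ F key
  { toFun := G
    map_smul' := fun c a => by
      obtain ⟨a, rfl⟩ := mk_surjective k L a
      exact hs c a
    map_zero' := map_zero G
    map_add' := map_add G
    map_mul' := map_mul G }

variable (f : L →ₗ[k] A) (comm : ∀ x y, f x * f y - f y * f x = f ⁅x, y⁆)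
    (left : ∀ x a b, associator (f x) a b + associator a (f x) b = 0)
    (right : ∀ x a b, associator a (f x) b + associator a b (f x) = 0)

theorem lift_ι (x : L) : lift f comm left right (ι k L x) = f x := freeLift_gen f x

theorem lift_one : lift f comm left right 1 = 1 := freeLift_one (k := k) f

end Lift

/-- The coproduct of `U(L)`: the homomorphism of unital algebras with `Δ x = x ⊗ 1 + 1 ⊗ x` for
all `x` in `L`. -/
def comulHom : Envelope k L →ₙₐ[k] Envelope k L ⊗[k] Envelope k L :=
  lift ((TensorProduct.mk k _ _).flip 1 ∘ₗ ι k L + TensorProduct.mk k _ _ 1 ∘ₗ ι k L)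
    (fun x y => by
      simp only [LinearMap.add_apply, LinearMap.comp_apply, LinearMap.flip_apply,
        TensorProduct.mk_apply, mul_add, add_mul, Algebra.TensorProduct.tmul_mul_tmul, mul_one,
        one_mul, ← ι_comm, TensorProduct.sub_tmul, TensorProduct.tmul_sub]
      abel)
    (fun x a b => by
      simp only [LinearMap.add_apply, LinearMap.comp_apply, LinearMap.flip_apply,
        TensorProduct.mk_apply]
      induction a with
      | zero => simp [associator]
      | add a a' h h' =>
        rw [← add_zero 0]
        nth_rewrite 1 [← h]
        rw [← h']
        simp only [associator, add_mul, mul_add]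
        abel
      | tmul a a' =>
        induction b with
        | zero => simp [associator]
        | add b b' h h' =>
          rw [← add_zero 0]
          nth_rewrite 1 [← h]
          rw [← h']
          simp only [associator, add_mul, mul_add]
          abel
        | tmul b b' =>
          have h₁ := congrArg (· ⊗ₜ[k] (a' * b')) (ι_left k L x a b)
          have h₂ := congrArg ((a * b) ⊗ₜ[k] ·) (ι_left k L x a' b')
          have h := congrArg₂ (· + ·) h₁ h₂
          simp only [associator, TensorProduct.add_tmul, TensorProduct.sub_tmul,
            TensorProduct.tmul_add, TensorProduct.tmul_sub, TensorProduct.zero_tmul,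
            TensorProduct.tmul_zero, add_zero] at h
          simp only [associator, add_mul, mul_add, Algebra.TensorProduct.tmul_mul_tmul, one_mul,
            mul_one]
          rw [← h]
          abel)
    (fun x a b => by
      simp only [LinearMap.add_apply, LinearMap.comp_apply, LinearMap.flip_apply,
        TensorProduct.mk_apply]
      induction a with
      | zero => simp [associator]
      | add a a' h h' =>
        rw [← add_zero 0]
        nth_rewrite 1 [← h]
        rw [← h']
        simp only [associator, add_mul, mul_add]
        abel
      | tmul a a' =>
        induction b with
        | zero => simp [associator]
        | add b b' h h' =>
          rw [← add_zero 0]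
          nth_rewrite 1 [← h]
          rw [← h']
          simp only [associator, add_mul, mul_add]
          abel
        | tmul b b' =>
          have h₁ := congrArg (· ⊗ₜ[k] (a' * b')) (ι_right k L x a b)
          have h₂ := congrArg ((a * b) ⊗ₜ[k] ·) (ι_right k L x a' b')
          have h := congrArg₂ (· + ·) h₁ h₂
          simp only [associator, TensorProduct.add_tmul, TensorProduct.sub_tmul,
            TensorProduct.tmul_add, TensorProduct.tmul_sub, TensorProduct.zero_tmul,
            TensorProduct.tmul_zero, add_zero] at h
          simp only [associator, add_mul, mul_add, Algebra.TensorProduct.tmul_mul_tmul, one_mul,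
            mul_one]
          rw [← h]
          abel)

theorem comulHom_ι (x : L) : comulHom k L (ι k L x) = ι k L x ⊗ₜ 1 + 1 ⊗ₜ ι k L x := by
  simp [comulHom, lift_ι]

theorem comulHom_one : comulHom k L 1 = 1 := lift_one ..

/-- The counit of `U(L)`: the homomorphism of unital algebras with `ε x = 0` for all `x` in `L`. -/
def counitHom : Envelope k L →ₙₐ[k] k :=
  lift 0 (by simp) (by simp [associator]) (by simp [associator])

theorem counitHom_ι (x : L) : counitHom k L (ι k L x) = 0 := by simp [counitHom, lift_ι]

theorem counitHom_one : counitHom k L 1 = 1 := lift_one ..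

/-- The antipode of `U(L)` as a homomorphism to the opposite algebra. -/
def antipodeHom : Envelope k L →ₙₐ[k] (Envelope k L)ᵐᵒᵖ :=
  lift (-((MulOpposite.opLinearEquiv k).toLinearMap ∘ₗ ι k L))
    (fun x y => by
      apply MulOpposite.unop_injective
      simp [← ι_comm])
    (fun x a b => by
      have h := ι_right k L x b.unop a.unop
      simp only [associator] at h
      apply MulOpposite.unop_injective
      simp only [associator, LinearMap.neg_apply, LinearMap.comp_apply, LinearEquiv.coe_coe,
        MulOpposite.coe_opLinearEquiv, MulOpposite.unop_add, MulOpposite.unop_sub,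
        MulOpposite.unop_mul, MulOpposite.unop_neg, MulOpposite.unop_op, MulOpposite.unop_zero,
        neg_mul, mul_neg]
      rw [← h]
      abel)
    (fun x a b => by
      have h := ι_left k L x b.unop a.unop
      simp only [associator] at h
      apply MulOpposite.unop_injective
      simp only [associator, LinearMap.neg_apply, LinearMap.comp_apply, LinearEquiv.coe_coe,
        MulOpposite.coe_opLinearEquiv, MulOpposite.unop_add, MulOpposite.unop_sub,
        MulOpposite.unop_mul, MulOpposite.unop_neg, MulOpposite.unop_op, MulOpposite.unop_zero,
        neg_mul, mul_neg]
      rw [← h]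
      abel)

/-- The antipode of `U(L)`: the linear antihomomorphism of unital algebras with `S x = -x` for all
`x` in `L`. -/
def antipode : Envelope k L →ₗ[k] Envelope k L :=
  (MulOpposite.opLinearEquiv k).symm.toLinearMap ∘ₗ (antipodeHom k L : _ →ₗ[k] _)

theorem antipode_ι (x : L) : antipode k L (ι k L x) = -ι k L x := by
  simp [antipode, antipodeHom, lift_ι]

theorem antipode_one : antipode k L 1 = 1 := by
  simp [antipode, antipodeHom, lift_one]

theorem antipode_mul (a b : Envelope k L) :
    antipode k L (a * b) = antipode k L b * antipode k L a := by
  simp [antipode]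

section TensorMul

variable {k} {A B C : Type*} [NonAssocRing A] [Module k A] [IsScalarTower k A A]
  [SMulCommClass k A A] [NonAssocRing B] [Module k B] [IsScalarTower k B B] [SMulCommClass k B B]
  [NonAssocRing C] [Module k C] [IsScalarTower k C C] [SMulCommClass k C C]

theorem rTensor_mul (f : A →ₗ[k] B) (hf : ∀ x y, f (x * y) = f x * f y) (a b : A ⊗[k] C) :
    f.rTensor C (a * b) = f.rTensor C a * f.rTensor C b := by
  induction a with
  | zero => simp
  | add a a' h h' => simp only [add_mul, map_add, h, h']
  | tmul a a' =>
    induction b with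
    | zero => simp
    | add b b' h h' => simp only [mul_add, map_add, h, h']
    | tmul b b' => simp [hf]

theorem lTensor_mul (f : A →ₗ[k] B) (hf : ∀ x y, f (x * y) = f x * f y) (a b : C ⊗[k] A) :
    f.lTensor C (a * b) = f.lTensor C a * f.lTensor C b := by
  induction a with
  | zero => simp
  | add a a' h h' => simp only [add_mul, map_add, h, h']
  | tmul a a' =>
    induction b with
    | zero => simp
    | add b b' h h' => simp only [mul_add, map_add, h, h']
    | tmul b b' => simp [hf]

theorem assoc_mul (a b : (A ⊗[k] B) ⊗[k] C) :
    TensorProduct.assoc k A B C (a * b) =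
      TensorProduct.assoc k A B C a * TensorProduct.assoc k A B C b := by
  induction a with
  | zero => simp
  | add a a' h h' => simp only [add_mul, map_add, h, h']
  | tmul a a' =>
    induction b with
    | zero => simp
    | add b b' h h' => simp only [mul_add, map_add, h, h']
    | tmul b b' =>
      induction a with
      | zero => simp
      | add a a' h h' => simp only [TensorProduct.add_tmul, add_mul, map_add, h, h']
      | tmul a a' =>
        induction b with
        | zero => simp
        | add b b' h h' => simp only [TensorProduct.add_tmul, mul_add, map_add, h, h']
        | tmul b b' => simp

end TensorMul

theorem comulHom_mul (a b : Envelope k L) :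
    (comulHom k L : _ →ₗ[k] Envelope k L ⊗[k] Envelope k L) (a * b) =
      (comulHom k L : _ →ₗ[k] Envelope k L ⊗[k] Envelope k L) a * (comulHom k L : _ →ₗ[k] Envelope k L ⊗[k] Envelope k L) b :=
  map_mul (comulHom k L) a b

theorem counitHom_mul (a b : Envelope k L) :
    (counitHom k L : _ →ₗ[k] k) (a * b) =
      (counitHom k L : _ →ₗ[k] k) a * (counitHom k L : _ →ₗ[k] k) b :=
  map_mul (counitHom k L) a b

instance : Coalgebra k (Envelope k L) where
  comul := comulHom k L
  counit := counitHom k L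
  coassoc := by
    ext a
    simp only [LinearMap.comp_apply, LinearEquiv.coe_coe]
    induction a using induction with
    | one => simp [comulHom_one, Algebra.TensorProduct.one_def]
    | of x =>
      simp [comulHom_ι, comulHom_one, Algebra.TensorProduct.one_def, TensorProduct.add_tmul,
        TensorProduct.tmul_add, add_assoc]
    | add a b h h' => simp only [map_add, h, h']
    | smul c a h => simp only [map_smul, h]
    | mul a b h h' =>
      rw [comulHom_mul, rTensor_mul _ (comulHom_mul k L), assoc_mul, h, h',
        lTensor_mul _ (comulHom_mul k L)]
  rTensor_counit_comp_comul := by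
    ext a
    simp only [LinearMap.comp_apply]
    induction a using induction with
    | one => simp [comulHom_one, counitHom_one, Algebra.TensorProduct.one_def]
    | of x => simp [comulHom_ι, counitHom_one, counitHom_ι]
    | add a b h h' => simp only [map_add, h, h']
    | smul c a h => simp only [map_smul, h]
    | mul a b h h' =>
      rw [comulHom_mul, rTensor_mul _ (counitHom_mul k L), h, h']
      simp
  lTensor_counit_comp_comul := by
    ext a
    simp only [LinearMap.comp_apply]
    induction a using induction with
    | one => simp [comulHom_one, counitHom_one, Algebra.TensorProduct.one_def]
    | of x => simp [comulHom_ι, counitHom_one, counitHom_ι]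
    | add a b h h' => simp only [map_add, h, h']
    | smul c a h => simp only [map_smul, h]
    | mul a b h h' =>
      rw [comulHom_mul, lTensor_mul _ (counitHom_mul k L), h, h']
      simp

theorem comul_ι (x : L) : Coalgebra.comul (R := k) (ι k L x) = ι k L x ⊗ₜ 1 + 1 ⊗ₜ ι k L x :=
  comulHom_ι k L x

theorem counit_ι (x : L) : Coalgebra.counit (R := k) (ι k L x) = 0 :=
  counitHom_ι k L x

end Envelope

end

end MaltsevAlgebra

/-! The relations say that in `U(L)` an associator with one entry `x` from `L` changes sign when `x`
is exchanged with a neighbour, so `(x,h,g) = -(h,x,g) = (h,g,x)`. Such an `x` can therefore be moved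
out of a product at the cost of terms in which `x` multiplies the other factors.

Two facts carry the proof. First, as `2` is invertible, `U(L)` is spanned by the words `x₁(x₂(⋯(xₙ
1)))` (`induction_left`), so every identity in `h` may be checked for `h = 1` and then passed from
`h` to `xh`. Second, `Δ(xh) = (x ⊗ 1 + 1 ⊗ x)Δ(h)`, so each Sweedler expression for `xh` is a
combination of the same expression for `h`, with `x` multiplied onto its value or its parameters
(the `mulMap_…` lemmas). If the identity for `h` is known for all parameters, it follows for `xh`.

For the antipode identities the resulting terms cancel, in accordance with `ε(xh) = 0`. For the
Moufang identity, induction shows that `f ↦ h₁(g(h₂f))` is a left multiplication, necessarily by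
`h₁(gh₂)`, and that `(h₁y)(zh₂)` depends only on `yz`. The latter gives `h₁(gh₂) = (h₁g)h₂`, which
turns the former into the required form. -/

namespace MaltsevAlgebra.Envelope

open Coalgebra LinearMap

/-! ### Moving an element of `L` through products -/

section Identities

variable {k L : Type*} [CommRing k] [AddCommGroup L] [Module k L] [MaltsevAlgebra k L]

/-- This is `(x,h,f) = (h,f,x)`, obtained by moving `x` past both other entries. The three rules
after it likewise take `x` out of an inner product. -/
theorem ι_mul_mul (x : L) (h f : Envelope k L) :
    (ι k L x * h) * f = ι k L x * (h * f) + (h * f) * ι k L x - h * (f * ι k L x) := by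
  have e₁ := ι_left k L x h f
  have e₂ := ι_right k L x h f
  simp only [associator] at e₁ e₂
  rw [← sub_eq_zero]
  refine Eq.trans ?_ ((congrArg₂ (· - ·) e₁ e₂).trans (sub_zero 0))
  abel

theorem mul_ι_mul (x : L) (h f : Envelope k L) :
    (h * ι k L x) * f = h * (ι k L x * f) + h * (f * ι k L x) - (h * f) * ι k L x := by
  have e := ι_right k L x h f
  simp only [associator] at e
  rw [← sub_eq_zero, ← e]
  abel

theorem mul_ι_mul' (x : L) (f h : Envelope k L) :
    f * (ι k L x * h) = (f * ι k L x) * h + (ι k L x * f) * h - ι k L x * (f * h) := by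
  have e := ι_left k L x f h
  simp only [associator] at e
  rw [eq_comm, ← sub_eq_zero, ← e]
  abel

theorem mul_mul_ι (x : L) (f h : Envelope k L) :
    f * (h * ι k L x) = ι k L x * (f * h) + (f * h) * ι k L x - (ι k L x * f) * h := by
  rw [ι_mul_mul]
  abel

/-- The associator of two elements of `L` with an arbitrary element is determined by left
multiplications by elements of `L`. -/
theorem two_smul_associator (x y : L) (h : Envelope k L) :
    (2 : k) • associator (ι k L x) (ι k L y) h =
      ι k L ⁅x, y⁆ * h - ι k L x * (ι k L y * h) + ι k L y * (ι k L x * h) := by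
  have e := ι_left k L x (ι k L y) h
  rw [two_smul, ← ι_comm, ← sub_eq_zero, ← e]
  simp only [associator, sub_mul]
  abel

theorem comul_ι_mul (x : L) (h : Envelope k L) :
    comul (R := k) (ι k L x * h) = (ι k L x ⊗ₜ 1 + 1 ⊗ₜ ι k L x) * comul (R := k) h := by
  rw [← comul_ι]
  exact comulHom_mul k L _ _

theorem counit_ι_mul (x : L) (h : Envelope k L) : counit (R := k) (ι k L x * h) = 0 := by
  have := counitHom_mul k L (ι k L x) h
  refine this.trans ?_
  rw [show (counitHom k L : _ →ₗ[k] k) (ι k L x) = 0 from counitHom_ι k L x, zero_mul]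

theorem comul_one' : comul (R := k) (1 : Envelope k L) = 1 ⊗ₜ 1 := comulHom_one k L

theorem counit_one' : counit (R := k) (1 : Envelope k L) = 1 := counitHom_one k L

end Identities

/-! ### Spanning by words bracketed to the right -/

section Induction

variable {k L : Type*} [Field k] [AddCommGroup L] [Module k L] [MaltsevAlgebra k L]

/-- If `2` is invertible then `U(L)` is spanned by the words `x₁ (x₂ (⋯ (xₙ 1)))` in elements
of `L`. -/
theorem induction_left (h2 : (2 : k) ≠ 0) {P : Envelope k L → Prop} (one : P 1)
    (add : ∀ a b, P a → P b → P (a + b)) (smul : ∀ (c : k) a, P a → P (c • a))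
    (ι_mul : ∀ x a, P a → P (ι k L x * a)) (a : Envelope k L) : P a := by
  let S : Set (Submodule k (Envelope k L)) :=
    {W | 1 ∈ W ∧ ∀ x, ∀ b ∈ W, ι k L x * b ∈ W}
  let W : Submodule k (Envelope k L) := sInf S
  have one_mem : (1 : Envelope k L) ∈ W := Submodule.mem_sInf.2 fun _ hV => hV.1
  have ι_mul_mem : ∀ x, ∀ b ∈ W, ι k L x * b ∈ W := fun x b hb =>
    Submodule.mem_sInf.2 fun V hV => hV.2 x b (Submodule.mem_sInf.1 hb V hV)
  have W_le (V : Submodule k (Envelope k L)) (h₁ : 1 ∈ V)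
      (h₂ : ∀ x, ∀ b ∈ V, ι k L x * b ∈ V) : W ≤ V := sInf_le ⟨h₁, h₂⟩
  have mul_ι_mem : ∀ x, ∀ b ∈ W, b * ι k L x ∈ W := by
    intro x b hb
    -- Intersecting with `W` keeps `b ∈ W` available in the inductive step, where the associator
    -- `(x,y,b)` has to lie in `W`.
    have hle : W ≤ W ⊓ W.comap (mulRight k (ι k L x)) := by
      refine W_le _ ⟨one_mem, ?_⟩ ?_
      · have := ι_mul_mem x 1 one_mem
        simpa using this
      · rintro y b ⟨hb, hb'⟩
        refine ⟨ι_mul_mem y b hb, ?_⟩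
        simp only [SetLike.mem_coe, Submodule.mem_comap, mulRight_apply] at hb' ⊢
        have hassoc : associator (ι k L x) (ι k L y) b ∈ W := by
          have := two_smul_associator (k := k) x y b
          rw [← inv_smul_smul₀ h2 (associator (ι k L x) (ι k L y) b), this]
          exact W.smul_mem _ (W.add_mem (W.sub_mem (ι_mul_mem _ _ hb)
            (ι_mul_mem _ _ (ι_mul_mem _ _ hb))) (ι_mul_mem _ _ (ι_mul_mem _ _ hb)))
        -- The error term is `(y,b,x) = (x,y,b)`, which half of `two_smul_associator` expresses by
        -- left multiplications alone.
        have e : (ι k L y * b) * ι k L x =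
            ι k L y * (b * ι k L x) + associator (ι k L x) (ι k L y) b := by
          rw [associator, ι_mul_mul x]
          abel
        rw [e]
        exact W.add_mem (ι_mul_mem _ _ hb') hassoc
    exact (hle hb).2
  have mul_mem : ∀ b ∈ W, ∀ c ∈ W, b * c ∈ W := by
    intro b hb
    -- The quantifier over all `c ∈ W` matters: expanding `(x * b) * c` uses `b` both with `c` and
    -- with `c * x`.
    let V : Submodule k (Envelope k L) :=
      { carrier := {b | ∀ c ∈ W, b * c ∈ W}
        add_mem' := fun h h' c hc => by rw [add_mul]; exact W.add_mem (h c hc) (h' c hc)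
        zero_mem' := fun c _ => by rw [zero_mul]; exact W.zero_mem
        smul_mem' := fun r b h c hc => by rw [smul_mul_assoc]; exact W.smul_mem r (h c hc) }
    have hle : W ≤ V := by
      refine W_le V (fun c hc => by rwa [one_mul]) fun x b hb c hc => ?_
      rw [ι_mul_mul]
      exact W.sub_mem (W.add_mem (ι_mul_mem _ _ (hb c hc)) (mul_ι_mem _ _ (hb c hc)))
        (hb _ (mul_ι_mem _ _ hc))
    exact hle hb
  have mem_W : a ∈ W := by
    induction a using induction with
    | one => exact one_mem
    | of x => simpa using ι_mul_mem x 1 one_mem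
    | add a b ha hb => exact W.add_mem ha hb
    | smul c a ha => exact W.smul_mem c ha
    | mul a b ha hb => exact mul_mem a ha b hb
  let V : Submodule k (Envelope k L) :=
    { carrier := {b | P b}
      add_mem' := fun h h' => add _ _ h h'
      zero_mem' := by
        have := smul 0 1 one
        rwa [zero_smul] at this
      smul_mem' := fun c b h => smul c b h }
  exact W_le V one (fun x b hb => ι_mul x b hb) mem_W

end Induction

/-! ### Effect of multiplying by `Δ x` on Sweedler expressions -/

section Sweedler

variable {k L : Type*} [CommRing k] [AddCommGroup L] [Module k L] [MaltsevAlgebra k L]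

/-- The linear map `a ⊗ b ↦ p(a) q(b)`. -/
noncomputable def mulMap (p q : Envelope k L →ₗ[k] Envelope k L) :
    Envelope k L ⊗[k] Envelope k L →ₗ[k] Envelope k L :=
  mul' k _ ∘ₗ TensorProduct.map p q

@[simp]
theorem mulMap_tmul (p q : Envelope k L →ₗ[k] Envelope k L) (a b : Envelope k L) :
    mulMap p q (a ⊗ₜ b) = p a * q b := rfl

/-- Multiplying by the coproduct of `x` in `L` changes `a ⊗ b ↦ a (g (b f))` as stated. -/
theorem mulMap_left_moufang (x : L) (g f : Envelope k L) (t : Envelope k L ⊗[k] Envelope k L) :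
    mulMap id (mulLeft k g ∘ₗ mulRight k f) ((ι k L x ⊗ₜ 1 + 1 ⊗ₜ ι k L x) * t) =
      ι k L x * mulMap id (mulLeft k g ∘ₗ mulRight k f) t +
        mulMap id (mulLeft k g ∘ₗ mulRight k f) t * ι k L x -
        mulMap id (mulLeft k g ∘ₗ mulRight k (f * ι k L x)) t +
        mulMap id (mulLeft k (g * ι k L x) ∘ₗ mulRight k f) t := by
  induction t with
  | zero => simp
  | add s t hs ht =>
    rw [mul_add, map_add, hs, ht]
    simp only [map_add, mul_add, add_mul]
    abel
  | tmul a b =>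
    simp only [add_mul, Algebra.TensorProduct.tmul_mul_tmul, one_mul, map_add, mulMap_tmul,
      id_apply, comp_apply, mulLeft_apply, mulRight_apply]
    rw [ι_mul_mul x a, ι_mul_mul x b f, mul_ι_mul x g (b * f)]
    simp only [mul_add, mul_sub]
    abel

/-- The recursion for the middle Moufang expression `(a y)(z b)`: only `y` and `z` absorb `x`, so
`t` stays unchanged for the induction. -/
theorem mulMap_middle_moufang (x : L) (y z : Envelope k L)
    (t : Envelope k L ⊗[k] Envelope k L) :
    mulMap (mulRight k y) (mulLeft k z) ((ι k L x ⊗ₜ 1 + 1 ⊗ₜ ι k L x) * t) =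
      ι k L x * mulMap (mulRight k y) (mulLeft k z) t -
        mulMap (mulRight k (y * ι k L x)) (mulLeft k z) t +
        mulMap (mulRight k y) (mulLeft k (z * ι k L x)) t +
        mulMap (mulRight k y) (mulLeft k (ι k L x * z)) t := by
  induction t with
  | zero => simp
  | add s t hs ht =>
    rw [mul_add, map_add, hs, ht]
    simp only [map_add, mul_add]
    abel
  | tmul a b =>
    simp only [add_mul, Algebra.TensorProduct.tmul_mul_tmul, one_mul, map_add, mulMap_tmul,
      mulLeft_apply, mulRight_apply]
    rw [ι_mul_mul x a y, mul_ι_mul' x z b]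
    simp only [mul_add, mul_sub, add_mul, sub_mul]
    rw [mul_ι_mul' x (a * y) (z * b)]
    abel

/-- Here `S(xa) = -S(a)x`; the terms `S(a)(x(bg))` coming from the two halves of `Δ x` cancel. -/
theorem mulMap_antipode_mul_left (x : L) (g : Envelope k L)
    (t : Envelope k L ⊗[k] Envelope k L) :
    mulMap (antipode k L) (mulRight k g) ((ι k L x ⊗ₜ 1 + 1 ⊗ₜ ι k L x) * t) =
      mulMap (antipode k L) (mulRight k g) t * ι k L x -
        mulMap (antipode k L) (mulRight k (g * ι k L x)) t := by
  induction t with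
  | zero => simp
  | add s t hs ht =>
    rw [mul_add, map_add, hs, ht]
    simp only [map_add, add_mul]
    abel
  | tmul a b =>
    simp only [add_mul, Algebra.TensorProduct.tmul_mul_tmul, one_mul, map_add, mulMap_tmul,
      mulRight_apply, antipode_mul, antipode_ι, mul_neg, neg_mul]
    rw [ι_mul_mul x b g, mul_ι_mul x (antipode k L a) (b * g)]
    simp only [mul_add, mul_sub]
    abel

theorem mulMap_mul_antipode_left (x : L) (g : Envelope k L)
    (t : Envelope k L ⊗[k] Envelope k L) :
    mulMap id (mulRight k g ∘ₗ antipode k L) ((ι k L x ⊗ₜ 1 + 1 ⊗ₜ ι k L x) * t) =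
      ι k L x * mulMap id (mulRight k g ∘ₗ antipode k L) t +
        mulMap id (mulRight k g ∘ₗ antipode k L) t * ι k L x -
        mulMap id (mulRight k (ι k L x * g) ∘ₗ antipode k L) t -
        mulMap id (mulRight k (g * ι k L x) ∘ₗ antipode k L) t := by
  induction t with
  | zero => simp
  | add s t hs ht =>
    rw [mul_add, map_add, hs, ht]
    simp only [map_add, mul_add, add_mul]
    abel
  | tmul a b =>
    simp only [add_mul, Algebra.TensorProduct.tmul_mul_tmul, one_mul, map_add, mulMap_tmul,
      id_apply, comp_apply, mulRight_apply, antipode_mul, antipode_ι, mul_neg, neg_mul]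
    rw [ι_mul_mul x a, mul_ι_mul x (antipode k L b) g]
    simp only [mul_add, mul_sub]
    abel

theorem mulMap_antipode_mul_right (x : L) (h : Envelope k L)
    (t : Envelope k L ⊗[k] Envelope k L) :
    mulMap (mulLeft k h ∘ₗ antipode k L) id ((ι k L x ⊗ₜ 1 + 1 ⊗ₜ ι k L x) * t) =
      mulMap (mulLeft k (ι k L x * h) ∘ₗ antipode k L) id t -
        ι k L x * mulMap (mulLeft k h ∘ₗ antipode k L) id t := by
  induction t with
  | zero => simp
  | add s t hs ht =>
    rw [mul_add, map_add, hs, ht]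
    simp only [map_add, mul_add]
    abel
  | tmul a b =>
    simp only [add_mul, Algebra.TensorProduct.tmul_mul_tmul, one_mul, map_add, mulMap_tmul,
      id_apply, comp_apply, mulLeft_apply, antipode_mul, antipode_ι, mul_neg, neg_mul]
    rw [mul_mul_ι x h (antipode k L a), mul_ι_mul' x (h * antipode k L a) b]
    simp only [add_mul, sub_mul]
    abel

theorem mulMap_mul_antipode_right (x : L) (h : Envelope k L)
    (t : Envelope k L ⊗[k] Envelope k L) :
    mulMap (mulLeft k h) (antipode k L) ((ι k L x ⊗ₜ 1 + 1 ⊗ₜ ι k L x) * t) =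
      mulMap (mulLeft k (h * ι k L x)) (antipode k L) t +
        mulMap (mulLeft k (ι k L x * h)) (antipode k L) t -
        ι k L x * mulMap (mulLeft k h) (antipode k L) t -
        mulMap (mulLeft k h) (antipode k L) t * ι k L x := by
  induction t with
  | zero => simp
  | add s t hs ht =>
    rw [mul_add, map_add, hs, ht]
    simp only [map_add, mul_add, add_mul]
    abel
  | tmul a b =>
    simp only [add_mul, Algebra.TensorProduct.tmul_mul_tmul, one_mul, map_add, mulMap_tmul,
      mulLeft_apply, antipode_mul, antipode_ι, mul_neg]
    rw [mul_ι_mul' x h a, mul_mul_ι x (h * a) (antipode k L b)]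
    simp only [add_mul, sub_mul]
    abel

end Sweedler

/-! ### The Moufang and antipode identities -/

section Hopf

variable {k L : Type*} [Field k] [AddCommGroup L] [Module k L] [MaltsevAlgebra k L]

/-- The left Moufang identity in the form `h₁(g(h₂ f)) = (h₁(g h₂)) f`. -/
theorem left_moufang (h2 : (2 : k) ≠ 0) (h g f : Envelope k L) :
    mulMap id (mulLeft k g ∘ₗ mulRight k f) (comul (R := k) h) =
      mulMap id (mulLeft k g) (comul (R := k) h) * f := by
  -- Leaving the multiplier unspecified makes the induction close; its value is recovered afterwards
  -- from `f = 1`.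
  have key : ∃ F : Envelope k L → Envelope k L, ∀ g f,
      mulMap id (mulLeft k g ∘ₗ mulRight k f) (comul (R := k) h) = F g * f := by
    induction h using induction_left h2 with
    | one => exact ⟨fun g => g, fun g f => by simp [comul_one']⟩
    | add a b ha hb =>
      obtain ⟨F, hF⟩ := ha
      obtain ⟨G, hG⟩ := hb
      exact ⟨fun g => F g + G g, fun g f => by simp only [map_add, hF, hG, add_mul]⟩
    | smul c a ha =>
      obtain ⟨F, hF⟩ := ha
      exact ⟨fun g => c • F g, fun g f => by simp only [map_smul, hF, smul_mul_assoc]⟩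
    | ι_mul x a ha =>
      obtain ⟨F, hF⟩ := ha
      -- By `ι_mul_mul`, the first three terms of the recursion assemble to `(x * F g) * f`; the
      -- fourth is `F (g * x) * f`.
      refine ⟨fun g => ι k L x * F g + F (g * ι k L x), fun g f => ?_⟩
      rw [comul_ι_mul, mulMap_left_moufang]
      simp only [hF, add_mul]
      rw [ι_mul_mul x (F g) f]
  obtain ⟨F, hF⟩ := key
  have e := hF g 1
  rw [mulRight_one, comp_id, mul_one] at e
  rw [hF, e]

/-- The flexible law `h₁(g h₂) = (h₁ g) h₂`, a consequence of the middle Moufang identity. -/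
theorem flexible (h2 : (2 : k) ≠ 0) (h g : Envelope k L) :
    mulMap id (mulLeft k g) (comul (R := k) h) = mulMap (mulRight k g) id (comul (R := k) h) := by
  -- The middle Moufang identity: the expression depends on `y` and `z` only through `y * z`.
  -- Linearity of `F` is needed to combine its values at `(y * x) * z`, `y * (z * x)` and `y * (x *
  -- z)` into `F ((y * z) * x)`.
  have key : ∃ F : Envelope k L →ₗ[k] Envelope k L, ∀ y z,
      mulMap (mulRight k y) (mulLeft k z) (comul (R := k) h) = F (y * z) := by
    induction h using induction_left h2 with
    | one => exact ⟨id, fun y z => by simp [comul_one']⟩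
    | add a b ha hb =>
      obtain ⟨F, hF⟩ := ha
      obtain ⟨G, hG⟩ := hb
      exact ⟨F + G, fun y z => by simp only [map_add, hF, hG, LinearMap.add_apply]⟩
    | smul c a ha =>
      obtain ⟨F, hF⟩ := ha
      exact ⟨c • F, fun y z => by simp only [map_smul, hF, LinearMap.smul_apply]⟩
    | ι_mul x a ha =>
      obtain ⟨F, hF⟩ := ha
      refine ⟨mulLeft k (ι k L x) ∘ₗ F + F ∘ₗ mulRight k (ι k L x), fun y z => ?_⟩
      rw [comul_ι_mul, mulMap_middle_moufang]
      simp only [hF, LinearMap.add_apply, comp_apply, mulLeft_apply, mulRight_apply]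
      rw [mul_ι_mul x y z]
      simp only [map_sub, map_add]
      abel
  obtain ⟨F, hF⟩ := key
  -- The factorizations `g = 1 * g = g * 1` give the two sides of the flexible law.
  have e₁ := hF 1 g
  have e₂ := hF g 1
  rw [mulRight_one, one_mul] at e₁
  rw [mulLeft_one, mul_one] at e₂
  rw [e₁, e₂]

theorem isMoufang (h2 : (2 : k) ≠ 0) : IsMoufang k (Envelope k L) := by
  intro h g f n a b hab
  have e := left_moufang h2 h g f
  rw [flexible h2, hab] at e
  simpa [Finset.sum_mul] using e

/-- The induction keeps `g` general because the recursion calls the hypothesis at `g` and at `g *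
x`; the two contributions `ε(a) g x` cancel. The three companions work in the same way. -/
theorem mulMap_antipode_mul_left_comul (h2 : (2 : k) ≠ 0) (h g : Envelope k L) :
    mulMap (antipode k L) (mulRight k g) (comul (R := k) h) = counit (R := k) h • g := by
  induction h using induction_left h2 generalizing g with
  | one => simp [comul_one', counit_one', antipode_one]
  | add a b ha hb => simp only [map_add, ha, hb, add_smul]
  | smul c a ha => simp only [map_smul, ha, smul_assoc]
  | ι_mul x a ha =>
    rw [comul_ι_mul, mulMap_antipode_mul_left, counit_ι_mul, ha, ha, smul_mul_assoc, sub_self,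
      zero_smul]

theorem mulMap_mul_antipode_left_comul (h2 : (2 : k) ≠ 0) (h g : Envelope k L) :
    mulMap id (mulRight k g ∘ₗ antipode k L) (comul (R := k) h) = counit (R := k) h • g := by
  induction h using induction_left h2 generalizing g with
  | one => simp [comul_one', counit_one', antipode_one]
  | add a b ha hb => simp only [map_add, ha, hb, add_smul]
  | smul c a ha => simp only [map_smul, ha, smul_assoc]
  | ι_mul x a ha =>
    rw [comul_ι_mul, mulMap_mul_antipode_left, counit_ι_mul, ha, ha, ha, smul_mul_assoc,
      mul_smul_comm, zero_smul]
    abel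

theorem mulMap_antipode_mul_right_comul (h2 : (2 : k) ≠ 0) (h g : Envelope k L) :
    mulMap (mulLeft k h ∘ₗ antipode k L) id (comul (R := k) g) = counit (R := k) g • h := by
  induction g using induction_left h2 generalizing h with
  | one => simp [comul_one', counit_one', antipode_one]
  | add a b ha hb => simp only [map_add, ha, hb, add_smul]
  | smul c a ha => simp only [map_smul, ha, smul_assoc]
  | ι_mul x a ha =>
    rw [comul_ι_mul, mulMap_antipode_mul_right, counit_ι_mul, ha, ha, mul_smul_comm, sub_self,
      zero_smul]

theorem mulMap_mul_antipode_right_comul (h2 : (2 : k) ≠ 0) (h g : Envelope k L) :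
    mulMap (mulLeft k h) (antipode k L) (comul (R := k) g) = counit (R := k) g • h := by
  induction g using induction_left h2 generalizing h with
  | one => simp [comul_one', counit_one', antipode_one]
  | add a b ha hb => simp only [map_add, ha, hb, add_smul]
  | smul c a ha => simp only [map_smul, ha, smul_assoc]
  | ι_mul x a ha =>
    rw [comul_ι_mul, mulMap_mul_antipode_right, counit_ι_mul, ha, ha, ha, smul_mul_assoc,
      mul_smul_comm, zero_smul]
    abel

theorem isHopfQuasigroup (h2 : (2 : k) ≠ 0) :
    IsHopfQuasigroup k (Envelope k L) (antipode k L) where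
  comul_one := comulHom_one k L
  comul_mul := comulHom_mul k L
  counit_one := counitHom_one k L
  counit_mul := counitHom_mul k L
  antipode_mul_left := by
    refine TensorProduct.ext' fun h g => ?_
    refine Eq.trans ?_ (mulMap_antipode_mul_left_comul h2 h g)
    -- Both sides are now linear in `Δ h`, so it can be replaced by an arbitrary tensor and then by
    -- a pure one.
    simp only [comp_apply, rTensor_tmul, LinearEquiv.coe_coe]
    induction comul (R := k) h with
    | zero => simp
    | add s t hs ht => simp only [TensorProduct.add_tmul, map_add, hs, ht]
    | tmul a b => simp
  mul_antipode_left := by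
    refine TensorProduct.ext' fun h g => ?_
    refine Eq.trans ?_ (mulMap_mul_antipode_left_comul h2 h g)
    simp only [comp_apply, rTensor_tmul, LinearEquiv.coe_coe]
    induction comul (R := k) h with
    | zero => simp
    | add s t hs ht => simp only [TensorProduct.add_tmul, map_add, hs, ht]
    | tmul a b => simp
  antipode_mul_right := by
    refine TensorProduct.ext' fun h g => ?_
    refine Eq.trans ?_ (mulMap_antipode_mul_right_comul h2 h g)
    simp only [comp_apply, lTensor_tmul, LinearEquiv.coe_coe]
    induction comul (R := k) g with
    | zero => simp
    | add s t hs ht => simp only [TensorProduct.tmul_add, map_add, hs, ht]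
    | tmul a b => simp
  mul_antipode_right := by
    refine TensorProduct.ext' fun h g => ?_
    refine Eq.trans ?_ (mulMap_mul_antipode_right_comul h2 h g)
    simp only [comp_apply, lTensor_tmul, LinearEquiv.coe_coe]
    induction comul (R := k) g with
    | zero => simp
    | add s t hs ht => simp only [TensorProduct.tmul_add, map_add, hs, ht]
    | tmul a b => simp

end Hopf

end MaltsevAlgebra.Envelope

theorem proposition4p9 (k L : Type*) [Field k] (h2 : (2 : k) ≠ 0) (h3 : (3 : k) ≠ 0)
    [AddCommGroup L] [Module k L] [MaltsevAlgebra k L] :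
    IsHopfQuasigroup k (MaltsevAlgebra.Envelope k L) (MaltsevAlgebra.Envelope.antipode k L) ∧
      IsMoufang k (MaltsevAlgebra.Envelope k L) := by
  exact ⟨MaltsevAlgebra.Envelope.isHopfQuasigroup h2, MaltsevAlgebra.Envelope.isMoufang h2⟩
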